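/- Let $n \in \mathbb{N}$ and let $Q$ be a locally countable Borel quasi-order on $\mathbb{R}^n$; that is, $Q$ is a reflexive and transitive binary relation on $\mathbb{R}^n$ such that $\{(x,y) : x \mathrel{Q} y\}$ is a Borel subset of $\mathbb{R}^n \times \mathbb{R}^n$ and, for every $y \in \mathbb{R}^n$, the set $\{x \in \mathbb{R}^n : x \mathrel{Q} y\}$ is countable. Then there is a closed set $A \subseteq \mathbb{R}^n$ which is a $Q$-antichain (no two distinct points $x, y \in A$ satisfy $x \mathrel{Q} y$) and which has Hausdorff dimension $n$ with respect to the Euclidean metric. -/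

import Mathlib

/-!
Let `Ψ : Y → ℝ → X` be Borel and injective on pairs, and let `θ : Y → ℝ` be Borel and injective.
For almost every `(v, u)`, almost every `w'` has no `w ≠ w'` with
`Q (Ψ w (u + v * θ w)) (Ψ w' (u + v * θ w'))`: for fixed `w'` and `p`, on the line
`u + v * θ w' = p` the right-hand point is the constant `Ψ w' p`, which has only countably many
predecessors, and each of them determines `w` and the value `p + v * (θ w - θ w')`, hence `v`.
So `w ↦ Ψ w (u + v * θ w)` maps a conull set onto an antichain, and inner regularity gives a compact
antichain whose set of parameters `w` has positive measure. The exceptional set is only known to be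
analytic, so its nullity is tested on compact subsets.

The dimension comes from the choice of `Ψ`: each coordinate of `Ψ w z` interleaves the binary digits
of `w i` with those of `z`, the latter placed at positions of density zero, so that `w` is recovered
from `Ψ w z` by a map which is Hölder of every exponent `r < 1`. The antichain then has dimension
at least `r` times that of a set of positive Lebesgue measure.
-/

open MeasureTheory Set Filter Topology Module
open scoped NNReal ENNReal

/-! ### Compact approximation of analytic sets -/

theorem exists_lt_measure_image_le {X : Type*} [MeasurableSpace X] (μ : Measure X)
    (f : (ℕ → ℕ) → X) {c : ℝ≥0∞} {T : Set (ℕ → ℕ)} (hT : c < μ (f '' T)) (m : ℕ) :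
    ∃ j, c < μ (f '' {x ∈ T | x m ≤ j}) := by
  have hunion : T = ⋃ j, {x ∈ T | x m ≤ j} := by
    ext x
    simpa using fun _ => ⟨x m, le_rfl⟩
  have hmono : Monotone fun j => f '' {x ∈ T | x m ≤ j} := fun j k hjk =>
    image_mono fun x hx => ⟨hx.1, hx.2.trans hjk⟩
  rw [hunion, image_iUnion, hmono.measure_iUnion] at hT
  exact lt_iSup_iff.1 hT

theorem exists_forall_lt_measure_image_le {X : Type*} [MeasurableSpace X] (μ : Measure X)
    (f : (ℕ → ℕ) → X) {c : ℝ≥0∞} (hc : c < μ (range f)) :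
    ∃ a : ℕ → ℕ, ∀ m, c < μ (f '' {x | ∀ i < m, x i ≤ a i}) := by
  choose! j hj using fun (T : Set (ℕ → ℕ)) (hT : c < μ (f '' T)) (m : ℕ) =>
    exists_lt_measure_image_le μ f hT m
  let T : ℕ → Set (ℕ → ℕ) := Nat.rec univ fun m T => {x ∈ T | x m ≤ j T m}
  have hT (m : ℕ) : T m = {x | ∀ i < m, x i ≤ j (T i) i} := by
    induction m with
    | zero => simp [T]
    | succ m ih =>
      ext x
      simp only [Nat.forall_lt_succ_right]
      change x ∈ T m ∧ x m ≤ j (T m) m ↔ _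
      exact and_congr_left' (by rw [ih]; rfl)
  refine ⟨fun m => j (T m) m, fun m => hT m ▸ ?_⟩
  induction m with
  | zero => rwa [← image_univ] at hc
  | succ m ih => exact hj _ ih m

theorem isCompact_Iic {α : Type*} [Preorder α] [OrderBot α] [TopologicalSpace α]
    [CompactIccSpace α] (a : α) : IsCompact (Iic a) :=
  Icc_bot (a := a) ▸ isCompact_Icc

theorem exists_setOf_forall_lt_le_subset {a : ℕ → ℕ} {V : Set (ℕ → ℕ)} (hV : IsOpen V)
    (h : Iic a ⊆ V) : ∃ m, {x : ℕ → ℕ | ∀ i < m, x i ≤ a i} ⊆ V := by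
  by_contra! hcon
  simp only [not_subset] at hcon
  choose x hxa hxV using hcon
  obtain ⟨y, hy, φ, hφ, hlim⟩ := (isCompact_Iic a).tendsto_subseq (x := fun m => x m ⊓ a)
    fun m => mem_Iic.2 inf_le_right
  have hlim' : Tendsto (x ∘ φ) atTop (𝓝 y) := by
    rw [tendsto_pi_nhds] at hlim ⊢
    intro i
    refine (hlim i).congr' ?_
    filter_upwards [eventually_gt_atTop i] with m hm
    exact min_eq_left (hxa (φ m) i (hm.trans_le hφ.le_apply))
  obtain ⟨m, hm⟩ := (hlim'.eventually (hV.mem_nhds (h hy))).exists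
  exact hxV _ hm

theorem exists_isCompact_lt_measure_of_analyticSet {X : Type*} [TopologicalSpace X]
    [MeasurableSpace X] {μ : Measure X} [μ.OuterRegular] {S : Set X} (hS : AnalyticSet S)
    {c : ℝ≥0∞} (hc : c < μ S) : ∃ K ⊆ S, IsCompact K ∧ c < μ K := by
  rw [AnalyticSet] at hS
  rcases hS with rfl | ⟨f, hf, rfl⟩
  · simp at hc
  obtain ⟨c', hcc', hc'⟩ := exists_between hc
  obtain ⟨a, ha⟩ := exists_forall_lt_measure_image_le μ f hc'
  refine ⟨f '' Iic a, image_subset_range _ _, (isCompact_Iic a).image hf, hcc'.trans_le ?_⟩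
  by_contra! hlt
  obtain ⟨U, hU, hUo, hUc⟩ := (f '' Iic a).exists_isOpen_lt_of_lt c' hlt
  obtain ⟨m, hm⟩ := exists_setOf_forall_lt_le_subset (hUo.preimage hf) (image_subset_iff.1 hU)
  exact ((ha m).trans_le (measure_mono (image_subset_iff.2 hm))).not_gt hUc

theorem measure_eq_zero_of_analyticSet {X : Type*} [TopologicalSpace X]
    [TopologicalSpace.PseudoMetrizableSpace X]
    [MeasurableSpace X] [BorelSpace X] {μ : Measure X} [SFinite μ] {S : Set X}
    (hS : AnalyticSet S) (h : ∀ K ⊆ S, IsCompact K → μ K = 0) : μ S = 0 := by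
  refine absolutelyContinuous_toFinite μ ?_
  by_contra hne
  obtain ⟨K, hKS, hK, hpos⟩ :=
    exists_isCompact_lt_measure_of_analyticSet hS (pos_iff_ne_zero.2 hne)
  exact hpos.ne' (toFinite_absolutelyContinuous μ (h K hKS hK))

theorem analyticSet_inter {X : Type*} [TopologicalSpace X] [T2Space X] {S T : Set X}
    (hS : AnalyticSet S) (hT : AnalyticSet T) : AnalyticSet (S ∩ T) := by
  rw [inter_eq_iInter]
  exact AnalyticSet.iInter (Bool.forall_bool.2 ⟨hT, hS⟩)

theorem analyticSet_preimage {X Y : Type*} [τ : TopologicalSpace X] [PolishSpace X]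
    [MeasurableSpace X] [BorelSpace X] [TopologicalSpace Y] [T2Space Y]
    [SecondCountableTopology Y] [MeasurableSpace Y] [OpensMeasurableSpace Y] {f : X → Y}
    (hf : Measurable f) {S : Set Y} (hS : AnalyticSet S) : AnalyticSet (f ⁻¹' S) := by
  obtain ⟨t, hle, hft, ht⟩ := hf.exists_continuous
  have hpre : @AnalyticSet X t (f ⁻¹' S) := @AnalyticSet.preimage X Y t _ ht _ _ hS _ hft
  simpa only [image_id] using
    @AnalyticSet.image_of_continuous X t X τ _ hpre id (continuous_id_of_le hle)

/-! ### Antichains along a random line -/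

theorem measure_prod_eq_zero_of_countable_sections {α G : Type*} [MeasurableSpace α]
    {μ : Measure α} [SFinite μ] [NullSingletonClass μ] [AddGroup G] [MeasurableSpace G]
    [MeasurableAdd G] [MeasurableSub₂ G] {ν : Measure G} [SFinite ν] [ν.IsAddRightInvariant]
    {g : α → G} (hg : Measurable g) {T : Set (α × G)} (hT : MeasurableSet T)
    (h : ∀ p, {v | (v, p - g v) ∈ T}.Countable) : (μ.prod ν) T = 0 := by
  have hshear : MeasurePreserving (fun q : α × G => (q.1, q.2 - g q.1)) (μ.prod ν) (μ.prod ν) :=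
    (MeasurePreserving.id μ).skew_product (measurable_snd.sub (hg.comp measurable_fst))
      (ae_of_all _ fun v => (measurePreserving_sub_right ν (g v)).map_eq)
  rw [← hshear.measure_preimage hT.nullMeasurableSet,
    Measure.prod_apply_symm (hshear.measurable hT)]
  exact lintegral_eq_zero_of_ae_eq_zero (ae_of_all _ fun p => (h p).measure_zero μ)

theorem countable_setOf_exists_apply_add_mul_mem {X Y : Type*} {D : Set Y} {Ψ : Y → ℝ → X}
    (hΨ : InjOn (fun q : Y × ℝ => Ψ q.1 q.2) (D ×ˢ univ)) {θ : Y → ℝ}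
    (hθ : Function.Injective θ) {S : Set X} (hS : S.Countable) (w' : Y) (p : ℝ) :
    {v : ℝ | ∃ w ∈ D, w ≠ w' ∧ Ψ w (p + v * (θ w - θ w')) ∈ S}.Countable := by
  have hfiber (x : X) :
      {v : ℝ | ∃ w ∈ D, w ≠ w' ∧ Ψ w (p + v * (θ w - θ w')) = x}.Subsingleton := by
    rintro v₁ ⟨w₁, hw₁, hne, h₁⟩ v₂ ⟨w₂, hw₂, -, h₂⟩
    have heq : (w₁, p + v₁ * (θ w₁ - θ w')) = (w₂, p + v₂ * (θ w₂ - θ w')) :=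
      hΨ (mk_mem_prod hw₁ (mem_univ _)) (mk_mem_prod hw₂ (mem_univ _)) (h₁.trans h₂.symm)
    obtain ⟨rfl, hshift⟩ := Prod.mk.inj heq
    exact mul_right_cancel₀ (sub_ne_zero.2 (hθ.ne hne)) (add_left_cancel hshift)
  refine (hS.biUnion fun x _ => (hfiber x).countable).mono ?_
  rintro v ⟨w, hw, hne, hmem⟩
  exact mem_biUnion hmem ⟨w, hw, hne, rfl⟩

section Antichain

variable {X Y : Type*} [TopologicalSpace X] [MeasurableSpace X]
  [BorelSpace X] [TopologicalSpace Y] [PolishSpace Y] [MeasurableSpace Y] [BorelSpace Y]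
  {μ : Measure Y} {Q : X → X → Prop} {D : Set Y} {Ψ : Y → ℝ → X} {θ : Y → ℝ}

theorem analyticSet_setOf_exists_rel_add_mul [T2Space X] [SecondCountableTopology X]
    (hQ : AnalyticSet {p : X × X | Q p.1 p.2})
    (hD : MeasurableSet D) (hΨ : Measurable fun q : Y × ℝ => Ψ q.1 q.2) (hθ : Measurable θ) :
    AnalyticSet {q : (ℝ × ℝ) × Y | ∃ w ∈ D, w ≠ q.2 ∧
      Q (Ψ w (q.1.2 + q.1.1 * θ w)) (Ψ q.2 (q.1.2 + q.1.1 * θ q.2))} := by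
  let f : ((ℝ × ℝ) × Y) × Y → X × X := fun q =>
    (Ψ q.2 (q.1.1.2 + q.1.1.1 * θ q.2), Ψ q.1.2 (q.1.1.2 + q.1.1.1 * θ q.1.2))
  have hf : Measurable f := by
    have hlt : Measurable fun q : ((ℝ × ℝ) × Y) × Y => (q.2, q.1.1.2 + q.1.1.1 * θ q.2) := by
      fun_prop
    have hgt : Measurable fun q : ((ℝ × ℝ) × Y) × Y => (q.1.2, q.1.1.2 + q.1.1.1 * θ q.1.2) := by
      fun_prop
    exact (hΨ.comp hlt).prodMk (hΨ.comp hgt)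
  have hdistinct : MeasurableSet {q : ((ℝ × ℝ) × Y) × Y | q.2 ∈ D ∧ q.2 ≠ q.1.2} :=
    (measurable_snd hD).inter
      (measurableSet_eq_fun measurable_snd (measurable_snd.comp measurable_fst)).compl
  convert (analyticSet_inter hdistinct.analyticSet
    (analyticSet_preimage hf hQ)).image_of_continuous continuous_fst
  ext ⟨⟨v, u⟩, w'⟩
  simp [f, and_assoc]

theorem exists_ae_forall_not_rel_add_mul [T2Space X] [SecondCountableTopology X] [SFinite μ]
    (hcount : ∀ y, {x | Q x y}.Countable)
    (hQ : AnalyticSet {p : X × X | Q p.1 p.2}) (hD : MeasurableSet D)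
    (hΨ : Measurable fun q : Y × ℝ => Ψ q.1 q.2)
    (hinj : InjOn (fun q : Y × ℝ => Ψ q.1 q.2) (D ×ˢ univ)) (hθ : Measurable θ)
    (hθi : Function.Injective θ) :
    ∃ v u : ℝ, ∀ᵐ w' ∂μ, ∀ w ∈ D, w ≠ w' → ¬ Q (Ψ w (u + v * θ w)) (Ψ w' (u + v * θ w')) := by
  have hnull := measure_eq_zero_of_analyticSet (μ := (volume : Measure (ℝ × ℝ)).prod μ)
    (analyticSet_setOf_exists_rel_add_mul hQ hD hΨ hθ) fun K hK hKc => by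
      rw [Measure.prod_apply_symm hKc.measurableSet]
      refine lintegral_eq_zero_of_ae_eq_zero (ae_of_all _ fun w' => ?_)
      refine measure_prod_eq_zero_of_countable_sections (measurable_id.mul_const (θ w'))
        (measurable_prodMk_right hKc.measurableSet) fun p => ?_
      refine (countable_setOf_exists_apply_add_mul_mem hinj hθi (hcount (Ψ w' p)) w'
        p).mono fun v hv => ?_
      obtain ⟨w, hw, hne, hq⟩ := hK hv
      refine ⟨w, hw, hne, ?_⟩
      have hshift : p + v * (θ w - θ w') = p - v * θ w' + v * θ w := by ring
      rw [mem_ofPred_eq, hshift]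
      simpa only [id, sub_add_cancel] using hq
  obtain ⟨⟨v, u⟩, hvu⟩ := (Measure.ae_ae_of_ae_prod (measure_eq_zero_iff_ae_notMem.1 hnull)).exists
  exact ⟨v, u, hvu.mono fun w' hw' w hw hne hq => hw' ⟨w, hw, hne, hq⟩⟩

theorem exists_isCompact_isAntichain_measure_ne_zero [PolishSpace X] [IsFiniteMeasure μ]
    (hcount : ∀ y, {x | Q x y}.Countable)
    (hQ : AnalyticSet {p : X × X | Q p.1 p.2}) (hD : MeasurableSet D) (hμD : μ D ≠ 0)
    (hΨ : Measurable fun q : Y × ℝ => Ψ q.1 q.2)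
    (hinj : InjOn (fun q : Y × ℝ => Ψ q.1 q.2) (D ×ˢ univ)) :
    ∃ A, IsCompact A ∧ IsAntichain Q A ∧ μ {w ∈ D | ∃ z, Ψ w z ∈ A} ≠ 0 := by
  have hθ := measurableEmbedding_embeddingReal Y
  obtain ⟨v, u, hvu⟩ := exists_ae_forall_not_rel_add_mul (μ := μ) hcount hQ hD hΨ hinj hθ.measurable
    hθ.injective
  let Φ : Y → X := fun w => Ψ w (u + v * embeddingReal Y w)
  have hΦ : Measurable Φ :=
    hΨ.comp (measurable_id.prodMk ((hθ.measurable.const_mul v).const_add u))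
  have hΦinj : InjOn Φ D := fun w hw w' hw' h =>
    congrArg Prod.fst (hinj (x₁ := (w, _)) (x₂ := (w', _)) ⟨hw, trivial⟩ ⟨hw', trivial⟩ h)
  obtain ⟨N, hN, hNm, hN0⟩ := exists_measurable_superset_of_null (ae_iff.1 hvu)
  have hgood : MeasurableSet (D \ N) := hD.diff hNm
  have himage : MeasurableSet (Φ '' (D \ N)) :=
    hgood.image_of_measurable_injOn hΦ (hΦinj.mono sdiff_subset)
  have hpos : 0 < (μ.restrict D).map Φ (Φ '' (D \ N)) := by
    rw [Measure.map_apply hΦ himage, Measure.restrict_apply (hΦ himage)]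
    calc 0 < μ (D \ N) := by rwa [measure_sdiff_null hN0, pos_iff_ne_zero]
      _ ≤ μ (Φ ⁻¹' (Φ '' (D \ N)) ∩ D) :=
        measure_mono (subset_inter (subset_preimage_image Φ _) sdiff_subset)
  obtain ⟨A, hAΦ, hA, hApos⟩ := himage.exists_lt_isCompact hpos
  refine ⟨A, hA, ?_, ?_⟩
  · intro x hx y hy hxy hq
    obtain ⟨w, hw, rfl⟩ := hAΦ hx
    obtain ⟨w', hw', rfl⟩ := hAΦ hy
    exact not_not.1 (notMem_subset hN hw'.2) w hw.1 (fun h => hxy (congrArg Φ h)) hq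
  · have hsub : Φ ⁻¹' A ∩ D ⊆ {w ∈ D | ∃ z, Ψ w z ∈ A} := fun w hw => ⟨hw.2, _, hw.1⟩
    rw [Measure.map_apply hΦ hA.measurableSet, Measure.restrict_apply (hΦ hA.measurableSet)]
      at hApos
    exact (hApos.trans_le (measure_mono hsub)).ne'

end Antichain

/-! ### Dimension bounds -/

theorem mul_dimH_image_le_of_edist_le {X Y Z : Type*} [EMetricSpace X] [EMetricSpace Y]
    {f : Z → X} {g : Z → Y} {S : Set Z} {C r : ℝ≥0}
    (h : ∀ p ∈ S, ∀ q ∈ S, edist (g p) (g q) ≤ C * edist (f p) (f q) ^ (r : ℝ)) :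
    r * dimH (g '' S) ≤ dimH (f '' S) := by
  rcases eq_or_ne r 0 with rfl | hr
  · simp
  rcases S.eq_empty_or_nonempty with rfl | ⟨p₀, -⟩
  · simp
  have : Nonempty Z := ⟨p₀⟩
  choose! s hs using fun x (hx : x ∈ f '' S) => hx
  have hholder : HolderOnWith C r (g ∘ s) (f '' S) := fun x hx y hy => by
    simpa only [Function.comp_apply, (hs x hx).2, (hs y hy).2] using h _ (hs x hx).1 _ (hs y hy).1
  have hsection : ∀ p ∈ S, g (s (f p)) = g p := fun p hp => by
    obtain ⟨hmem, heq⟩ := hs _ (mem_image_of_mem f hp)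
    have := h _ hmem _ hp
    rw [heq, edist_self, ENNReal.zero_rpow_of_pos (mod_cast pos_iff_ne_zero.2 hr), mul_zero] at this
    exact edist_le_zero.1 this
  have himage : (g ∘ s) '' (f '' S) = g '' S := by
    rw [image_image]
    exact image_congr hsection
  have hdim := hholder.dimH_image_le (pos_iff_ne_zero.2 hr)
  rw [himage] at hdim
  rw [mul_comm]
  exact ENNReal.mul_le_of_le_div hdim

theorem card_le_dimH_of_volume_ne_zero {ι : Type*} [Fintype ι] {V : Set (ι → ℝ)}
    (hV : volume V ≠ 0) : (Fintype.card ι : ℝ≥0∞) ≤ dimH V := by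
  rw [← hausdorffMeasure_pi_real] at hV
  exact mod_cast le_dimH_of_hausdorffMeasure_ne_zero (d := (Fintype.card ι : ℝ≥0)) (mod_cast hV)

/-! ### A coding by digits with Hölder inverse -/

theorem ofDigits_le_one_sub_of_eq_zero {b : ℕ} [NeZero b] (hb : 1 < b) {x : ℕ → Fin b} {p : ℕ}
    (hp : x p = 0) : Real.ofDigits x ≤ 1 - ((b : ℝ) ^ (p + 1))⁻¹ := by
  have hb' : (2 : ℝ) ≤ b := mod_cast Nat.succ_le_of_lt hb
  induction p generalizing x with
  | zero =>
    rw [Real.ofDigits_eq_sum_add_ofDigits x 1]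
    have hinv : (b : ℝ)⁻¹ ≤ 2⁻¹ := by gcongr
    have htail := mul_le_of_le_one_right (a := (b : ℝ)⁻¹) (by positivity)
      (Real.ofDigits_le_one fun i => x (i + 1))
    simp only [Finset.sum_range_one, Real.ofDigitsTerm, hp, Fin.val_zero, Nat.cast_zero, zero_mul,
      zero_add, pow_one]
    linarith
  | succ p ih =>
    rw [Real.ofDigits_eq_sum_add_ofDigits x 1]
    have hhead := Real.ofDigitsTerm_le (digits := x) (n := 0)
    have htail := mul_le_mul_of_nonneg_left (ih (x := fun i => x (i + 1)) hp)
      (inv_nonneg.2 (Nat.cast_nonneg b))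
    rw [Finset.sum_range_one, pow_one]
    refine (add_le_add hhead htail).trans_eq ?_
    field_simp
    ring

theorem le_ofDigits_sub_ofDigits {b : ℕ} [NeZero b] (hb : 1 < b) {x y : ℕ → Fin b} {n p : ℕ}
    (hxy : ∀ i < n, x i = y i) (hn : x n < y n) (hnp : n < p) (hp : x p = 0) :
    ((b : ℝ) ^ (p + 1))⁻¹ ≤ Real.ofDigits y - Real.ofDigits x := by
  obtain ⟨q, rfl⟩ := Nat.exists_eq_add_of_lt hnp
  have hsum : ∑ i ∈ Finset.range n, Real.ofDigitsTerm x i =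
      ∑ i ∈ Finset.range n, Real.ofDigitsTerm y i :=
    Finset.sum_congr rfl fun i hi => by simp only [Real.ofDigitsTerm, hxy i (Finset.mem_range.1 hi)]
  have hhead : ((b : ℝ) ^ (n + 1))⁻¹ ≤ Real.ofDigitsTerm y n - Real.ofDigitsTerm x n := by
    have hdigit : (x n + 1 : ℝ) ≤ y n := mod_cast hn
    rw [Real.ofDigitsTerm, Real.ofDigitsTerm, ← sub_mul]
    exact le_mul_of_one_le_left (by positivity) (by linarith)
  have htail : Real.ofDigits (fun i => x (i + (n + 1))) ≤ 1 - ((b : ℝ) ^ (q + 1))⁻¹ :=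
    ofDigits_le_one_sub_of_eq_zero hb (by rw [← hp]; congr 1; ring)
  rw [Real.ofDigits_eq_sum_add_ofDigits x (n + 1), Real.ofDigits_eq_sum_add_ofDigits y (n + 1),
    Finset.sum_range_succ, Finset.sum_range_succ, hsum]
  calc ((b : ℝ) ^ (n + q + 1 + 1))⁻¹
      = ((b : ℝ) ^ (n + 1))⁻¹ - ((b : ℝ) ^ (n + 1))⁻¹ * (1 - ((b : ℝ) ^ (q + 1))⁻¹) := by
        rw [show n + q + 1 + 1 = (n + 1) + (q + 1) by ring, pow_add, mul_inv]; ring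
    _ ≤ (Real.ofDigitsTerm y n - Real.ofDigitsTerm x n) -
          ((b : ℝ) ^ (n + 1))⁻¹ * Real.ofDigits (fun i => x (i + (n + 1))) := by gcongr
    _ ≤ _ := by
        have := mul_nonneg (inv_nonneg.2 (pow_nonneg (Nat.cast_nonneg (α := ℝ) b) (n + 1)))
          (Real.ofDigits_nonneg fun i => y (i + (n + 1)))
        linarith

theorem le_abs_ofDigits_sub_ofDigits {b : ℕ} [NeZero b] (hb : 1 < b) {x y : ℕ → Fin b} {n p : ℕ}
    (hxy : ∀ i < n, x i = y i) (hn : x n ≠ y n) (hnp : n < p) (hx : x p = 0) (hy : y p = 0) :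
    ((b : ℝ) ^ (p + 1))⁻¹ ≤ |Real.ofDigits x - Real.ofDigits y| := by
  rcases hn.lt_or_gt with h | h
  · rw [abs_sub_comm]
    exact (le_ofDigits_sub_ofDigits hb hxy h hnp hx).trans (le_abs_self _)
  · exact (le_ofDigits_sub_ofDigits hb (fun i hi => (hxy i hi).symm) h hnp hy).trans (le_abs_self _)

theorem measurable_digits (b : ℕ) [NeZero b] : Measurable fun x : ℝ => Real.digits x b :=
  measurable_pi_iff.2 fun i =>
    (measurable_from_top (f := Fin.ofNat b)).comp
      (Nat.measurable_floor.comp (measurable_id.mul_const ((b : ℝ) ^ (i + 1))))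

theorem injOn_digits {b : ℕ} [NeZero b] (hb : 1 < b) :
    InjOn (fun x => Real.digits x b) (Ico 0 1) := fun x hx y hy h => by
  rw [← Real.ofDigits_digits hb hx, ← Real.ofDigits_digits hb hy]
  exact congrArg Real.ofDigits h

/-- The interleaving of `x` and `y` in which the entries of `y` are sparse: position `k ^ 2` holds
`0`, position `(k + 1) ^ 2 + 1` holds `y k`, and the entries of `x` fill the remaining positions in
order. In a digit expansion the zeros stop carries, so that nearby values force long common
prefixes, and a prefix of length `(k + 1) ^ 2` still contains the first `k ^ 2` entries of `x`. The
subtractions do not truncate in the branches where they occur. -/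
def sparseInterleave {α : Type*} [Zero α] (x y : ℕ → α) (p : ℕ) : α :=
  if p = p.sqrt ^ 2 then 0
  else if p = p.sqrt ^ 2 + 1 then y (p.sqrt - 1)
  else x (p - (2 * p.sqrt + 1))

theorem sparseInterleave_sq {α : Type*} [Zero α] (x y : ℕ → α) (k : ℕ) :
    sparseInterleave x y (k ^ 2) = 0 := by
  rw [sparseInterleave, Nat.sqrt_eq', if_pos rfl]

theorem sparseInterleave_sq_add_one {α : Type*} [Zero α] (x y : ℕ → α) (k : ℕ) :
    sparseInterleave x y ((k + 1) ^ 2 + 1) = y k := by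
  have hsqrt : ((k + 1) ^ 2 + 1).sqrt = k + 1 := Nat.sqrt_add_eq' _ (by lia)
  simp [sparseInterleave, hsqrt]

theorem sparseInterleave_add {α : Type*} [Zero α] (x y : ℕ → α) {i k : ℕ}
    (hk : i ≤ 2 * k) :
    sparseInterleave x y ((k + 1) ^ 2 + 2 + i) = x (k ^ 2 + i) := by
  have hsqrt : ((k + 1) ^ 2 + 2 + i).sqrt = k + 1 := by
    rw [add_assoc]; exact Nat.sqrt_add_eq' _ (by lia)
  rw [sparseInterleave, hsqrt, if_neg (by lia), if_neg (by lia)]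
  congr 1
  grind

theorem eq_of_sparseInterleave_eq {α : Type*} [Zero α] {x y x' y' : ℕ → α} {k : ℕ}
    (h : ∀ p < (k + 1) ^ 2, sparseInterleave x y p = sparseInterleave x' y' p) {i : ℕ}
    (hi : i < k ^ 2) : x i = x' i := by
  have hlt : i.sqrt < k := Nat.sqrt_lt'.2 hi
  obtain ⟨a, ha⟩ := Nat.exists_eq_add_of_le i.sqrt_le'
  have hle : a ≤ 2 * i.sqrt := by grind [Nat.sqrt_le_add i]
  have hpos : (i.sqrt + 1) ^ 2 + 2 + a < (k + 1) ^ 2 := by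
    have := Nat.pow_le_pow_left (Nat.add_le_add_right hlt 1) 2
    grind
  have := h _ hpos
  rwa [sparseInterleave_add _ _ hle, sparseInterleave_add _ _ hle, ← ha] at this

theorem sparseInterleave_inj {α : Type*} [Zero α] {x y x' y' : ℕ → α}
    (h : sparseInterleave x y = sparseInterleave x' y') : x = x' ∧ y = y' := by
  refine ⟨funext fun i => ?_, funext fun k => ?_⟩
  · exact eq_of_sparseInterleave_eq (k := i + 1) (fun p _ => congrFun h p) (by grind)
  · rw [← sparseInterleave_sq_add_one x y, h, sparseInterleave_sq_add_one]

theorem measurable_sparseInterleave {α : Type*} [Zero α] [MeasurableSpace α] :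
    Measurable fun q : (ℕ → α) × (ℕ → α) => sparseInterleave q.1 q.2 := by
  refine measurable_pi_iff.2 fun p => ?_
  unfold sparseInterleave
  split_ifs <;> fun_prop

/-- The binary code of a pair `(s, t)` of numbers in `[0, 1)`: an injective Borel map to the line
from which `s` is recovered by a map that is Hölder of every exponent less than `1`. -/
noncomputable def digitCode (s t : ℝ) : ℝ :=
  Real.ofDigits (sparseInterleave (Real.digits s 2) (Real.digits t 2))

theorem measurable_digitCode : Measurable fun q : ℝ × ℝ => digitCode q.1 q.2 :=
  Real.continuous_ofDigits.measurable.comp <| measurable_sparseInterleave.comp <|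
    ((measurable_digits 2).comp measurable_fst).prodMk ((measurable_digits 2).comp measurable_snd)

theorem exists_le_abs_digitCode_sub {s t s' t' : ℝ}
    (hne : sparseInterleave (Real.digits s 2) (Real.digits t 2) ≠
      sparseInterleave (Real.digits s' 2) (Real.digits t' 2)) :
    ∃ k : ℕ, (∀ i < k ^ 2, Real.digits s 2 i = Real.digits s' 2 i) ∧
      ((2 : ℝ) ^ ((k + 2) ^ 2 + 1))⁻¹ ≤ |digitCode s t - digitCode s' t'| := by
  obtain ⟨n, hn, hlt⟩ := Nat.findX (Function.ne_iff.1 hne)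
  simp only [not_not] at hlt
  have hn0 : n ≠ 0 := by
    rintro rfl
    exact hn (by rw [← zero_pow two_ne_zero, sparseInterleave_sq, sparseInterleave_sq])
  obtain ⟨k, hk⟩ : ∃ k, n.sqrt = k + 1 :=
    Nat.exists_eq_add_one.2 (Nat.sqrt_pos.2 (Nat.pos_of_ne_zero hn0))
  have hkn : (k + 1) ^ 2 ≤ n := hk ▸ n.sqrt_le'
  have hnk : n < (k + 2) ^ 2 := by have := n.lt_succ_sqrt'; rwa [hk] at this
  refine ⟨k, fun i => eq_of_sparseInterleave_eq fun p hp => hlt p (hp.trans_le hkn), ?_⟩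
  exact mod_cast le_abs_ofDigits_sub_ofDigits one_lt_two hlt hn hnk (sparseInterleave_sq _ _ _)
    (sparseInterleave_sq _ _ _)

theorem digitCode_inj {s t s' t' : ℝ} (hs : s ∈ Ico (0 : ℝ) 1) (ht : t ∈ Ico (0 : ℝ) 1)
    (hs' : s' ∈ Ico (0 : ℝ) 1) (ht' : t' ∈ Ico (0 : ℝ) 1) (h : digitCode s t = digitCode s' t') :
    s = s' ∧ t = t' := by
  have heq : sparseInterleave (Real.digits s 2) (Real.digits t 2) =
      sparseInterleave (Real.digits s' 2) (Real.digits t' 2) := by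
    by_contra hne
    obtain ⟨k, -, hk⟩ := exists_le_abs_digitCode_sub hne
    rw [h, sub_self, abs_zero] at hk
    exact absurd hk (not_le.2 (by positivity))
  obtain ⟨hx, hy⟩ := sparseInterleave_inj heq
  exact ⟨injOn_digits one_lt_two hs hs' hx, injOn_digits one_lt_two ht ht' hy⟩

theorem exists_forall_mul_add_two_sq_add_one_le {r : ℝ} (hr : r < 1) :
    ∃ c : ℝ, ∀ k : ℕ, r * (((k : ℝ) + 2) ^ 2 + 1) ≤ k ^ 2 + c := by
  have hr' : 0 < 1 - r := sub_pos.2 hr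
  -- With `a = 1 - r`, the difference is `a * k ^ 2 - 4 * (1 - a) * k + …`; complete
  -- the square in `k`.
  refine ⟨5 + 4 / (1 - r), fun k => sub_nonneg.1 ?_⟩
  have hsq : (k ^ 2 + (5 + 4 / (1 - r)) - r * (((k : ℝ) + 2) ^ 2 + 1)) * (1 - r) =
      ((1 - r) * k - 2) ^ 2 + 4 * (1 - r) ^ 2 * k + 5 * (1 - r) ^ 2 := by
    field_simp
    ring
  exact nonneg_of_mul_nonneg_left (hsq ▸ by positivity) hr'

theorem exists_forall_inv_two_pow_sq_le {r : ℝ} (hr : r < 1) :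
    ∃ C : ℝ≥0, ∀ k : ℕ, ((2 : ℝ) ^ (k ^ 2))⁻¹ ≤ C * (((2 : ℝ) ^ ((k + 2) ^ 2 + 1))⁻¹) ^ r := by
  obtain ⟨c, hc⟩ := exists_forall_mul_add_two_sq_add_one_le hr
  have hexp (m : ℕ) : ((2 : ℝ) ^ m)⁻¹ = 2 ^ (-m : ℝ) := by
    rw [Real.rpow_neg zero_le_two, Real.rpow_natCast]
  refine ⟨2 ^ c, fun k => ?_⟩
  rw [hexp, hexp, NNReal.coe_rpow, NNReal.coe_ofNat, ← Real.rpow_mul zero_le_two,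
    ← Real.rpow_add two_pos]
  refine Real.rpow_le_rpow_of_exponent_le one_le_two ?_
  push_cast
  linarith [hc k]

theorem exists_edist_le_edist_digitCode_rpow {r : ℝ≥0} (hr : r < 1) :
    ∃ C : ℝ≥0, ∀ s ∈ Ico (0 : ℝ) 1, ∀ s' ∈ Ico (0 : ℝ) 1, ∀ t t' : ℝ,
      edist s s' ≤ C * edist (digitCode s t) (digitCode s' t') ^ (r : ℝ) := by
  obtain ⟨C, hC⟩ := exists_forall_inv_two_pow_sq_le (r := r) (mod_cast hr)
  refine ⟨C, fun s hs s' hs' t t' => ?_⟩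
  by_cases hx : Real.digits s 2 = Real.digits s' 2
  · rw [injOn_digits one_lt_two hs hs' hx, edist_self]
    exact zero_le
  obtain ⟨k, hagree, hcode⟩ := exists_le_abs_digitCode_sub (s := s) (t := t) (s' := s') (t' := t')
    fun h => hx (sparseInterleave_inj h).1
  have hdist : |s - s'| ≤ C * |digitCode s t - digitCode s' t'| ^ (r : ℝ) :=
    calc |s - s'| ≤ ((2 : ℝ) ^ (k ^ 2))⁻¹ := by
          simpa only [Real.ofDigits_digits one_lt_two hs, Real.ofDigits_digits one_lt_two hs',
            Nat.cast_ofNat] using Real.abs_ofDigits_sub_ofDigits_le hagree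
      _ ≤ C * (((2 : ℝ) ^ ((k + 2) ^ 2 + 1))⁻¹) ^ (r : ℝ) := hC k
      _ ≤ C * |digitCode s t - digitCode s' t'| ^ (r : ℝ) := by gcongr
  rw [edist_dist, edist_dist, Real.dist_eq, Real.dist_eq,
    ENNReal.ofReal_rpow_of_nonneg (abs_nonneg _) r.coe_nonneg, ← ENNReal.ofReal_coe_nnreal,
    ← ENNReal.ofReal_mul C.coe_nonneg]
  exact ENNReal.ofReal_le_ofReal hdist

/-- The coding `Ψ w z` of a point `w` of the unit cube and a real number `z`, which codes `z` into
every coordinate of `w`. The sigmoid brings `z` into `(0, 1)`, where `digitCode` is injective. -/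
noncomputable def cubeCode {ι : Type*} (w : ι → ℝ) (z : ℝ) : ι → ℝ :=
  fun i => digitCode (w i) (Real.sigmoid z)

theorem measurable_cubeCode {ι : Type*} :
    Measurable fun q : (ι → ℝ) × ℝ => cubeCode q.1 q.2 := by
  refine measurable_pi_iff.2 fun i => ?_
  have hcoord : Measurable fun q : (ι → ℝ) × ℝ => (q.1 i, Real.sigmoid q.2) := by fun_prop
  simpa only [cubeCode, Function.comp_def] using measurable_digitCode.comp hcoord

theorem injOn_cubeCode {ι : Type*} [Nonempty ι] :
    InjOn (fun q : (ι → ℝ) × ℝ => cubeCode q.1 q.2) ((univ.pi fun _ => Ico 0 1) ×ˢ univ) := by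
  rintro ⟨w, z⟩ ⟨hw, -⟩ ⟨w', z'⟩ ⟨hw', -⟩ h
  have hmem (z : ℝ) : Real.sigmoid z ∈ Ico (0 : ℝ) 1 :=
    ⟨Real.sigmoid_nonneg z, Real.sigmoid_lt_one z⟩
  have hcoord (i : ι) : w i = w' i ∧ Real.sigmoid z = Real.sigmoid z' :=
    digitCode_inj (hw i trivial) (hmem z) (hw' i trivial) (hmem z') (congrFun h i)
  obtain ⟨i⟩ := ‹Nonempty ι›
  exact Prod.ext (funext fun i => (hcoord i).1) (Real.sigmoid_injective (hcoord i).2)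

theorem exists_edist_le_edist_cubeCode_rpow {ι : Type*} [Fintype ι] {r : ℝ≥0} (hr : r < 1) :
    ∃ C : ℝ≥0, ∀ w ∈ univ.pi fun _ : ι => Ico (0 : ℝ) 1, ∀ w' ∈ univ.pi fun _ : ι => Ico (0 : ℝ) 1,
      ∀ z z' : ℝ, edist w w' ≤ C * edist (cubeCode w z) (cubeCode w' z') ^ (r : ℝ) := by
  obtain ⟨C, hC⟩ := exists_edist_le_edist_digitCode_rpow hr
  refine ⟨C, fun w hw w' hw' z z' => edist_pi_le_iff.2 fun i => ?_⟩
  refine (hC _ (hw i trivial) _ (hw' i trivial) (Real.sigmoid z) (Real.sigmoid z')).trans ?_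
  gcongr
  exact edist_le_pi_edist (cubeCode w z) (cubeCode w' z') i

theorem card_le_dimH_of_volume_cubeCode_ne_zero {ι : Type*} [Fintype ι] {A : Set (ι → ℝ)}
    (hA : volume {w ∈ univ.pi fun _ => Ico 0 1 | ∃ z, cubeCode w z ∈ A} ≠ 0) :
    (Fintype.card ι : ℝ≥0∞) ≤ dimH A := by
  let S : Set ((ι → ℝ) × ℝ) := {q | q.1 ∈ univ.pi (fun _ => Ico 0 1) ∧ cubeCode q.1 q.2 ∈ A}
  have hfst : Prod.fst '' S = {w ∈ univ.pi fun _ => Ico 0 1 | ∃ z, cubeCode w z ∈ A} := by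
    ext w
    simp [S]
  refine ENNReal.le_of_forall_lt_one_mul_le fun r hr => ?_
  lift r to ℝ≥0 using hr.ne_top
  obtain ⟨C, hC⟩ := exists_edist_le_edist_cubeCode_rpow (ι := ι) (r := r) (mod_cast hr)
  calc (r : ℝ≥0∞) * Fintype.card ι ≤ r * dimH (Prod.fst '' S) := by
        gcongr
        exact card_le_dimH_of_volume_ne_zero (hfst ▸ hA)
    _ ≤ dimH ((fun q => cubeCode q.1 q.2) '' S) :=
        mul_dimH_image_le_of_edist_le fun p hp q hq => hC _ hp.1 _ hq.1 _ _
    _ ≤ dimH A := dimH_mono (image_subset_iff.2 fun q hq => hq.2)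

theorem exists_isCompact_isAntichain_dimH_eq_card {ι : Type*} [Fintype ι]
    {Q : (ι → ℝ) → (ι → ℝ) → Prop} (hcount : ∀ y, {x | Q x y}.Countable)
    (hQ : AnalyticSet {p : (ι → ℝ) × (ι → ℝ) | Q p.1 p.2}) :
    ∃ A, IsCompact A ∧ IsAntichain Q A ∧ dimH A = Fintype.card ι := by
  rcases isEmpty_or_nonempty ι with _ | _
  · exact ⟨univ, isCompact_univ, subsingleton_univ.isAntichain Q, Real.dimH_univ_pi ι⟩
  have hvol : volume (univ.pi fun _ : ι => Ico (0 : ℝ) 1) = 1 := by simp [Real.volume_pi_Ico]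
  have : IsFiniteMeasure (volume.restrict (univ.pi fun _ : ι => Ico (0 : ℝ) 1)) :=
    isFiniteMeasure_restrict.2 (by simp [hvol])
  obtain ⟨A, hA, hanti, hV⟩ := exists_isCompact_isAntichain_measure_ne_zero hcount hQ
    (MeasurableSet.univ_pi fun _ => measurableSet_Ico)
    (by rw [Measure.restrict_apply_self, hvol]; exact one_ne_zero)
    measurable_cubeCode injOn_cubeCode
  have hdim := card_le_dimH_of_volume_cubeCode_ne_zero
    (ne_bot_of_le_ne_bot hV (Measure.restrict_apply_le _ _))
  exact ⟨A, hA, hanti, hdim.antisymm'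
    ((dimH_mono (subset_univ A)).trans_eq (Real.dimH_univ_pi ι))⟩

theorem mainTheorem6_general {E : Type*} [NormedAddCommGroup E] [NormedSpace ℝ E]
    [FiniteDimensional ℝ E] {Q : E → E → Prop} (hcount : ∀ y, {x | Q x y}.Countable)
    (hQ : AnalyticSet {p : E × E | Q p.1 p.2}) :
    ∃ A, IsCompact A ∧ IsAntichain Q A ∧ dimH A = finrank ℝ E := by
  let L := (finBasis ℝ E).equivFunL
  obtain ⟨A, hA, hanti, hdim⟩ := exists_isCompact_isAntichain_dimH_eq_card
    (Q := fun x y => Q (L.symm x) (L.symm y))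
    (fun y => (hcount (L.symm y)).preimage L.symm.injective)
    (hQ.preimage (L.symm.continuous.prodMap L.symm.continuous))
  refine ⟨L.symm '' A, hA.image L.symm.continuous, ?_, ?_⟩
  · exact hanti.image L.symm fun _ _ h => by simpa using h
  · rw [L.symm.dimH_image, hdim, Fintype.card_fin]

theorem mainTheorem6 (n : ℕ)
    (Q : EuclideanSpace ℝ (Fin n) → EuclideanSpace ℝ (Fin n) → Prop)
    (hrefl : ∀ x, Q x x)
    (htrans : ∀ x y z, Q x y → Q y z → Q x z)
    (hcount : ∀ y, {x | Q x y}.Countable)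
    (hborel : MeasurableSet
      {p : EuclideanSpace ℝ (Fin n) × EuclideanSpace ℝ (Fin n) | Q p.1 p.2}) :
    ∃ A : Set (EuclideanSpace ℝ (Fin n)), IsClosed A ∧ IsAntichain Q A ∧ dimH A = n := by
  obtain ⟨A, hA, hanti, hdim⟩ := mainTheorem6_general hcount hborel.analyticSet
  exact ⟨A, hA.isClosed, hanti, by rw [hdim, finrank_euclideanSpace_fin]⟩
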